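/- Let $G=(V,E)$ be an infinite, locally finite, connected (simple) graph, and for $f:V\to\mathbb R$ put $\Delta f(x)=\sum_{y\sim x}\bigl(f(x)-f(y)\bigr)$. Fix a vertex $o$. For $r\in\mathbb N$ let $B_r$ be the ball of radius $r$ about $o$ in the graph distance, let $\operatorname{int}B_r$ be the set of vertices of $B_r$ all of whose neighbours lie in $B_r$, and let $\Delta_r$ be the Laplacian $\Delta$ compressed to the functions vanishing outside $\operatorname{int}B_r$. Let $p^r_t(x,y)$ be the kernel of $e^{-t\Delta_r}$, extended by $0$ off $\operatorname{int}B_r$, let $p_t(x,y)=\lim_{r\to\infty}p^r_t(x,y)$ be the heat kernel of $G$, and put $P_tf(x)=\sum_{y\in V}p_t(x,y)f(y)$ for bounded $f$. Write $\mathbf 1$ for the constant function $1$. A function $v:V\to\mathbb R$ is called $\lambda$-harmonic if $\Delta v=\lambda v$, and $\lambda$-subharmonic if $\Delta v\le\lambda v$. For all $t>0$ and $x\in V$ the series $P_t\mathbf 1(x)=\sum_{y}p_t(x,y)$ converges, and the following statements are equivalent: 1. $P_t\mathbf 1(x)<1$ for some $t>0$ and some $x\in V$; 2. $P_t\mathbf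 1(x)<1$ for all $t>0$ and all $x\in V$; 3. for every (equivalently, for some) $\lambda<0$ there is a positive (equivalently, a non-zero) bounded $\lambda$-harmonic function on $G$; 4. for every (equivalently, for some) $\lambda<0$ there is a bounded $\lambda$-subharmonic function on $G$ that is positive everywhere (equivalently, positive at some vertex); 5. there is a bounded function $u:V\times[0,\infty)\to\mathbb R$, not identically zero, continuous in $t\in[0,\infty)$ and differentiable in $t\in(0,\infty)$ for each $x$, with $\Delta u(x,t)+\frac{\partial u}{\partial t}(x,t)=0$ for all $x\in V$, $t>0$, and $u(x,0)=0$ for all $x\in V$. Each "equivalently" is part of the claim: all the variants of 3 and 4 belong to the list of equivalent statements. -/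

import Mathlib

open Filter Topology

namespace GraphHeat

variable {V : Type*} (G : SimpleGraph V)

/-- The set of vertices of the ball `B_r(o)` of radius `r` about `o` for the graph distance. -/
def ball (o : V) (r : ℕ) : Set V := {x | G.edist o x ≤ r}

/-- The interior of `B_r(o)`: the vertices of the ball all of whose neighbours lie in the ball. -/
def ballInterior (o : V) (r : ℕ) : Set V :=
  {x | x ∈ ball G o r ∧ ∀ y, G.Adj x y → y ∈ ball G o r}

/-- Balls of a locally finite graph are finite. -/
theorem finite_ball [G.LocallyFinite] (o : V) (r : ℕ) : (ball G o r).Finite := by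
  induction r with
  | zero =>
    refine (Set.finite_singleton o).subset fun x hx => ?_
    have h : G.edist o x ≤ ((0 : ℕ) : ℕ∞) := hx
    exact (SimpleGraph.edist_eq_zero_iff.mp (nonpos_iff_eq_zero.mp h)).symm
  | succ n ih =>
    refine (ih.union (ih.biUnion fun x _ => (G.neighborSet x).toFinite)).subset fun y hy => ?_
    have hne : G.edist o y ≠ ⊤ := fun h => by
      have hy' : G.edist o y ≤ ((n + 1 : ℕ) : ℕ∞) := hy
      rw [h, top_le_iff] at hy'
      exact ENat.natCast_ne_top _ hy'
    obtain ⟨p, hp⟩ := SimpleGraph.exists_walk_of_edist_ne_top hne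
    have hlen : p.length ≤ n + 1 := by
      have hy' : G.edist o y ≤ ((n + 1 : ℕ) : ℕ∞) := hy
      rw [← hp] at hy'
      exact_mod_cast hy'
    by_cases h0 : p.length = 0
    · left
      obtain rfl := SimpleGraph.Walk.eq_of_length_eq_zero h0
      simp [ball]
    · right
      have hnil : ¬ p.Nil := fun h => h0 (SimpleGraph.Walk.length_eq_zero_iff.mpr h)
      refine Set.mem_biUnion (x := p.penultimate) ?_ (p.adj_penultimate hnil)
      refine (SimpleGraph.edist_le p.dropLast).trans ?_
      have hd : p.dropLast.length ≤ n := by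
        have := SimpleGraph.Walk.length_dropLast_add_one hnil
        omega
      exact_mod_cast hd

instance finite_ballInterior [G.LocallyFinite] (o : V) (r : ℕ) : Finite (ballInterior G o r) :=
  ((finite_ball G o r).subset fun _ hx => hx.1).to_subtype

noncomputable section

/-- The combinatorial Laplacian `Δ f (x) = ∑_{y ∼ x} (f x - f y)`. -/
def laplacian [G.LocallyFinite] (f : V → ℝ) (x : V) : ℝ :=
  ∑ y ∈ G.neighborFinset x, (f x - f y)

/-- A bounded function on the vertices. -/
def IsBoundedFun (v : V → ℝ) : Prop := ∃ C : ℝ, ∀ x, |v x| ≤ C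

/-- `v` is `c`-harmonic: `Δ v = c v`. -/
def IsHarmonic [G.LocallyFinite] (c : ℝ) (v : V → ℝ) : Prop :=
  ∀ x, laplacian G v x = c * v x

/-- `v` is `c`-subharmonic: `Δ v ≤ c v`. -/
def IsSubharmonic [G.LocallyFinite] (c : ℝ) (v : V → ℝ) : Prop :=
  ∀ x, laplacian G v x ≤ c * v x

open Classical in
/-- The reduced Laplacian `Δ_r` of `B_r(o)`, acting on functions that vanish off the interior of
`B_r(o)`, as a matrix in the basis of delta functions: its entry at `(x, y)` is `(Δ δ_y)(x)`. -/
def reducedLaplacian [G.LocallyFinite] (o : V) (r : ℕ) :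
    Matrix (ballInterior G o r) (ballInterior G o r) ℝ :=
  Matrix.of fun x y => laplacian G (Pi.single (y : V) 1) x

open Classical in
/-- The Dirichlet heat kernel `p_t^r(x, y)` of `B_r(o)`: the kernel of `exp (-t Δ_r)`, extended by
zero off the interior of `B_r(o)`. -/
def dirichletHeatKernel [G.LocallyFinite] (o : V) (r : ℕ) (t : ℝ) (x y : V) : ℝ :=
  letI := Fintype.ofFinite (ballInterior G o r)
  if h : x ∈ ballInterior G o r ∧ y ∈ ballInterior G o r then
    NormedSpace.exp (-(t • reducedLaplacian G o r)) ⟨x, h.1⟩ ⟨y, h.2⟩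
  else 0

/-- The heat kernel `p_t(x, y) = lim_{r → ∞} p_t^r(x, y)`, built from the exhaustion of the graph
by the balls about `o`. -/
def heatKernel [G.LocallyFinite] (o : V) (t : ℝ) (x y : V) : ℝ :=
  limUnder atTop fun r : ℕ => dirichletHeatKernel G o r t x y

/-- The heat semigroup `P_t f (x) = ∑_y p_t(x, y) f(y)`. -/
def heatSemigroup [G.LocallyFinite] (o : V) (t : ℝ) (f : V → ℝ) (x : V) : ℝ :=
  ∑' y, heatKernel G o t x y * f y

/-- `u` solves the heat equation `Δ u + ∂u/∂t = 0` on `V × (0, ∞)` with initial data `u₀`;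
it is continuous in time up to `t = 0`. Values at negative times are irrelevant. -/
structure IsHeatSolution [G.LocallyFinite] (u₀ : V → ℝ) (u : V → ℝ → ℝ) : Prop where
  continuousOn : ∀ x, ContinuousOn (u x) (Set.Ici 0)
  hasDerivAt : ∀ x, ∀ t, 0 < t → HasDerivAt (u x) (-laplacian G (fun y => u y t) x) t
  initial : ∀ x, u x 0 = u₀ x

end

end GraphHeat

/-!
All statements are compared with one function, the escape probability
`escape G o x t = 1 - P_t 1 (x) ∈ [0, 1]`.

On the interior of a ball the matrix exponential solves the heat equation, and the parabolic minimum
principle on finite sets (`nonneg_of_supersolution`) shows that the Dirichlet kernels are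
non-negative, increase with the radius and have row sums at most `1`. So the limit defining the heat
kernel exists and is summable, and dominated convergence in the integrated heat equation shows that
the escape probability is a heat solution with zero initial data (`isHeatSolution_escape`). The same
minimum principle on the balls bounds any subsolution with initial values at most `m` and all values
at most `M` by `m + (M - m) * escape` (`le_add_mul_escape`).

Applied to a bounded solution `u` with zero initial data, this bound shows that `u = 0` if there is
no escape. Applied to `e^{-ct} v` with `v` bounded and `c`-subharmonic, `c < 0`, on `[0, T]`, it
gives `v ≤ e^{cT} sup |v|` if there is no escape, so that `v ≤ 0` on letting `T → ∞`
(`IsSubharmonic.exists_escape_pos`). Conversely, the Laplace transform of the escape probability is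
bounded and `c`-harmonic (`isHarmonic_escapeTransform`), and positive where the escape probability
is.

It remains to see that escape at one vertex and time means escape at all of them (`escape_pos`).
If the escape probability vanishes at one vertex and one positive time, then by the heat equation and
connectedness it vanishes at all vertices for all earlier times. Restarting the clock then gives a
heat solution with zero initial data, which is dominated by the escape probability; iterating, the
escape probability vanishes for all times. This comparison takes the place of the semigroup
property of the heat kernel.
-/

namespace GraphHeat

/-! ### The Laplacian -/

section Laplacian

variable {V : Type*} (G : SimpleGraph V) [G.LocallyFinite]

theorem laplacian_sub (f g : V → ℝ) (x : V) :
    laplacian G (fun y => f y - g y) x = laplacian G f x - laplacian G g x := by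
  simp only [laplacian, ← Finset.sum_sub_distrib]
  exact Finset.sum_congr rfl fun y _ => by ring

theorem laplacian_const_mul (a : ℝ) (f : V → ℝ) (x : V) :
    laplacian G (fun y => a * f y) x = a * laplacian G f x := by
  simp only [laplacian, Finset.mul_sum]
  exact Finset.sum_congr rfl fun y _ => by ring

@[simp]
theorem laplacian_const (a : ℝ) (x : V) : laplacian G (fun _ => a) x = 0 := by
  simp [laplacian]

theorem laplacian_const_sub (a : ℝ) (f : V → ℝ) (x : V) :
    laplacian G (fun y => a - f y) x = -laplacian G f x := by
  simp [laplacian_sub G (fun _ => a) f x]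

theorem laplacian_sum {ι : Type*} (s : Finset ι) (f : ι → V → ℝ) (x : V) :
    laplacian G (fun y => ∑ i ∈ s, f i y) x = ∑ i ∈ s, laplacian G (f i) x := by
  simp only [laplacian, ← Finset.sum_sub_distrib]
  exact Finset.sum_comm

theorem laplacian_eq_degree_mul_sub (f : V → ℝ) (x : V) :
    laplacian G f x = G.degree x * f x - ∑ y ∈ G.neighborFinset x, f y := by
  simp [laplacian, Finset.sum_sub_distrib]

theorem abs_laplacian_le_degree {f : V → ℝ} (h0 : ∀ y, 0 ≤ f y) (h1 : ∀ y, f y ≤ 1) (x : V) :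
    |laplacian G f x| ≤ G.degree x := by
  refine (Finset.abs_sum_le_sum_abs _ _).trans ?_
  refine (Finset.sum_le_card_nsmul _ _ 1 fun y _ => ?_).trans (by simp)
  rw [abs_le]
  constructor <;> linarith [h0 x, h0 y, h1 x, h1 y]

theorem tendsto_laplacian {ι : Type*} {l : Filter ι} {F : ι → V → ℝ} {f : V → ℝ}
    (h : ∀ y, Tendsto (fun i => F i y) l (𝓝 (f y))) (x : V) :
    Tendsto (fun i => laplacian G (F i) x) l (𝓝 (laplacian G f x)) :=
  tendsto_finsetSum _ fun y _ => (h x).sub (h y)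

theorem continuousOn_laplacian {s : Set ℝ} {F : V → ℝ → ℝ} (h : ∀ y, ContinuousOn (F y) s) (x : V) :
    ContinuousOn (fun t => laplacian G (fun y => F y t) x) s :=
  continuousOn_finsetSum _ fun y _ => (h x).sub (h y)

end Laplacian

/-! ### The parabolic maximum principle -/

section MaximumPrinciple

variable {V : Type*} (G : SimpleGraph V) [G.LocallyFinite]

/-- Minimum principle: a supersolution of the heat equation on a finite set of vertices that is
non-negative initially and on the complement of the set is non-negative. -/
theorem nonneg_of_supersolution {S : Set V} (hS : S.Finite) {T : ℝ} {f f' : V → ℝ → ℝ}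
    (hcont : ∀ x ∈ S, ContinuousOn (f x) (Set.Icc 0 T))
    (hderiv : ∀ x ∈ S, ∀ t ∈ Set.Ioc 0 T, HasDerivAt (f x) (f' x t) t)
    (hsuper : ∀ x ∈ S, ∀ t ∈ Set.Ioc 0 T, 0 ≤ f' x t + laplacian G (fun y => f y t) x)
    (hinit : ∀ x ∈ S, 0 ≤ f x 0)
    (hbdry : ∀ x ∉ S, ∀ t ∈ Set.Icc 0 T, 0 ≤ f x t) :
    ∀ x, ∀ t ∈ Set.Icc 0 T, 0 ≤ f x t := by
  by_contra! hneg
  obtain ⟨x₁, t₁, ht₁, hlt⟩ := hneg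
  have hT : (0 : ℝ) ≤ T := ht₁.1.trans ht₁.2
  have hx₁ : x₁ ∈ S := by
    by_contra h
    exact absurd (hbdry x₁ h t₁ ht₁) (not_le.mpr hlt)
  -- Adding `ε * t` makes the supersolution strict and, for small `ε`, keeps a negative value.
  obtain ⟨ε, hε, hε₁⟩ : ∃ ε : ℝ, 0 < ε ∧ f x₁ t₁ + ε * t₁ < 0 := by
    refine ⟨-f x₁ t₁ / (2 * (T + 1)), div_pos (by linarith) (by linarith), ?_⟩
    have h1 : -f x₁ t₁ / (2 * (T + 1)) * t₁ ≤ -f x₁ t₁ / (2 * (T + 1)) * (T + 1) :=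
      mul_le_mul_of_nonneg_left (by linarith [ht₁.2])
        (div_pos (by linarith) (by linarith)).le
    have h2 : -f x₁ t₁ / (2 * (T + 1)) * (T + 1) = -f x₁ t₁ / 2 := by
      field_simp
    linarith
  set g : V → ℝ → ℝ := fun x t => f x t + ε * t with hg
  have hmin : ∀ x ∈ S, ∃ t ∈ Set.Icc 0 T, ∀ s ∈ Set.Icc 0 T, g x t ≤ g x s := fun x hx =>
    isCompact_Icc.exists_isMinOn (Set.nonempty_Icc.mpr hT)
      ((hcont x hx).add (by fun_prop))
  choose! τ hτ hτmin using hmin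
  obtain ⟨x, hx, hxmin⟩ := S.exists_min_image (fun x => g x (τ x)) hS ⟨x₁, hx₁⟩
  have hgmin : ∀ y ∈ S, ∀ s ∈ Set.Icc 0 T, g x (τ x) ≤ g y s := fun y hy s hs =>
    (hxmin y hy).trans (hτmin y hy s hs)
  have hgneg : g x (τ x) < 0 := (hgmin x₁ hx₁ t₁ ht₁).trans_lt hε₁
  have hτpos : 0 < τ x := by
    refine lt_of_le_of_ne (hτ x hx).1 fun h0 => ?_
    have : g x (τ x) = f x 0 := by simp [hg, ← h0]
    linarith [hinit x hx]
  have hmem : τ x ∈ Set.Ioc 0 T := ⟨hτpos, (hτ x hx).2⟩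
  have hgd : HasDerivAt (g x) (f' x (τ x) + ε) (τ x) := by
    simpa using (hderiv x hx _ hmem).fun_add ((hasDerivAt_id (τ x)).const_mul ε)
  have hd : f' x (τ x) + ε ≤ 0 := by
    have hloc : IsLocalMinOn (g x) (Set.Icc 0 (τ x)) (τ x) :=
      IsMinOn.localize fun s hs => hgmin x hx s ⟨hs.1, hs.2.trans (hτ x hx).2⟩
    have htan : (0 : ℝ) - τ x ∈ posTangentConeAt (Set.Icc 0 (τ x)) (τ x) := by
      refine sub_mem_posTangentConeAt_of_segment_subset ?_
      rw [segment_symm, segment_eq_Icc hτpos.le]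
    have := hloc.hasFDerivWithinAt_nonneg hgd.hasFDerivAt.hasFDerivWithinAt htan
    simp at this
    nlinarith
  have hlap : laplacian G (fun y => f y (τ x)) x ≤ 0 := by
    refine Finset.sum_nonpos fun y _ => ?_
    by_cases hy : y ∈ S
    · have := hgmin y hy (τ x) (hτ x hx)
      simp only [hg] at this
      linarith
    · have h1 := hbdry y hy (τ x) (hτ x hx)
      have h2 : f x (τ x) + ε * τ x < 0 := hgneg
      nlinarith
  linarith [hsuper x hx _ hmem]

end MaximumPrinciple

/-! ### Exhaustion by balls -/

section Exhaustion

variable {V : Type*} (G : SimpleGraph V)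

theorem ball_mono (o : V) : Monotone (ball G o) := fun r s hrs _ hx =>
  le_trans (show G.edist o _ ≤ r from hx) (by exact_mod_cast hrs)

theorem ballInterior_mono (o : V) : Monotone (ballInterior G o) := fun _ _ hrs _ hx =>
  ⟨ball_mono G o hrs hx.1, fun y hy => ball_mono G o hrs (hx.2 y hy)⟩

theorem finite_ballInterior_set [G.LocallyFinite] (o : V) (r : ℕ) : (ballInterior G o r).Finite :=
  Set.toFinite _

theorem eventually_mem_ballInterior [G.LocallyFinite] (hG : G.Connected) (o x : V) :
    ∀ᶠ r in atTop, x ∈ ballInterior G o r := by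
  have hball : ∀ y, ∀ᶠ r in atTop, y ∈ ball G o r := fun y => by
    have hne : G.edist o y ≠ ⊤ := SimpleGraph.edist_ne_top_iff_reachable.mpr (hG.preconnected o y)
    obtain ⟨n, hn⟩ := ENat.ne_top_iff_exists.mp hne
    filter_upwards [eventually_ge_atTop n] with r hr
    exact ball_mono G o hr (show G.edist o y ≤ n from hn.ge)
  have hnbr : ∀ᶠ r in atTop, ∀ y ∈ G.neighborFinset x, y ∈ ball G o r :=
    (Finset.eventually_all _).mpr fun y _ => hball y
  filter_upwards [hball x, hnbr] with r h1 h2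
  exact ⟨h1, fun y hy => h2 y (by simpa using hy)⟩

end Exhaustion

/-! ### The Dirichlet heat kernels -/

section Dirichlet

variable {V : Type*} (G : SimpleGraph V) [G.LocallyFinite]

theorem dirichletHeatKernel_eq_zero_left {o : V} {r : ℕ} {t : ℝ} {x : V}
    (hx : x ∉ ballInterior G o r) (y : V) : dirichletHeatKernel G o r t x y = 0 :=
  dif_neg fun h => hx h.1

theorem dirichletHeatKernel_eq_zero_right {o : V} {r : ℕ} {t : ℝ} {y : V}
    (hy : y ∉ ballInterior G o r) (x : V) : dirichletHeatKernel G o r t x y = 0 :=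
  dif_neg fun h => hy h.2

open Classical in
theorem dirichletHeatKernel_zero {o : V} {r : ℕ} {x : V} (hx : x ∈ ballInterior G o r) (y : V) :
    dirichletHeatKernel G o r 0 x y = if x = y then 1 else 0 := by
  by_cases hy : y ∈ ballInterior G o r
  · rw [dirichletHeatKernel, dif_pos ⟨hx, hy⟩]
    simp [Matrix.one_apply]
  · rw [dirichletHeatKernel_eq_zero_right G hy, if_neg]
    rintro rfl
    exact hy hx

/-- On functions supported in the interior of the ball, the matrix `reducedLaplacian` acts as the
Laplacian. -/
theorem sum_reducedLaplacian_mul (o : V) (r : ℕ) [Fintype (ballInterior G o r)]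
    {f : V → ℝ} (hf : ∀ y ∉ ballInterior G o r, f y = 0) (x : ballInterior G o r) :
    ∑ z, reducedLaplacian G o r x z * f z = laplacian G f x := by
  classical
  have hfsum : f = fun y =>
      ∑ z : ballInterior G o r, f z * Pi.single (M := fun _ => ℝ) (z : V) 1 y := by
    funext y
    by_cases hy : y ∈ ballInterior G o r
    · rw [Finset.sum_eq_single ⟨y, hy⟩]
      · simp
      · intro z _ hz
        have : y ≠ z := fun h => hz (Subtype.ext h.symm)
        simp [this]
      · simp
    · rw [hf y hy, Finset.sum_eq_zero]
      intro z _
      have : y ≠ z := fun h => hy (h ▸ z.2)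
      simp [this]
  conv_rhs => rw [hfsum, laplacian_sum]
  refine Finset.sum_congr rfl fun z _ => ?_
  rw [laplacian_const_mul, mul_comm, reducedLaplacian, Matrix.of_apply]

/-- The Dirichlet heat kernel solves the heat equation in its first variable. -/
theorem hasDerivAt_dirichletHeatKernel {o : V} {r : ℕ} {x : V} (hx : x ∈ ballInterior G o r)
    (y : V) (t : ℝ) :
    HasDerivAt (fun s => dirichletHeatKernel G o r s x y)
      (-laplacian G (fun z => dirichletHeatKernel G o r t z y) x) t := by
  classical
  by_cases hy : y ∈ ballInterior G o r
  · let _ := Fintype.ofFinite (ballInterior G o r)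
    let _ : NormedRing (Matrix (ballInterior G o r) (ballInterior G o r) ℝ) :=
      Matrix.linftyOpNormedRing
    let _ : NormedAlgebra ℝ (Matrix (ballInterior G o r) (ballInterior G o r) ℝ) :=
      Matrix.linftyOpNormedAlgebra
    set A := reducedLaplacian G o r with hA
    have hexp : HasDerivAt (fun s : ℝ => NormedSpace.exp (s • -A))
        (-A * NormedSpace.exp (t • -A)) t := hasDerivAt_exp_smul_const' (-A) t
    let ev : Matrix (ballInterior G o r) (ballInterior G o r) ℝ →ₗ[ℝ] ℝ :=
      { toFun := fun M => M ⟨x, hx⟩ ⟨y, hy⟩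
        map_add' := fun _ _ => rfl
        map_smul' := fun _ _ => rfl }
    have hent := (LinearMap.toContinuousLinearMap ev).hasFDerivAt.comp_hasDerivAt t hexp
    have hker : ∀ (s : ℝ) (z : ballInterior G o r),
        dirichletHeatKernel G o r s z y = NormedSpace.exp (s • -A) z ⟨y, hy⟩ := fun s z => by
      rw [dirichletHeatKernel, dif_pos ⟨z.2, hy⟩, smul_neg]
    have hval : -laplacian G (fun z => dirichletHeatKernel G o r t z y) x
        = (-A * NormedSpace.exp (t • -A)) ⟨x, hx⟩ ⟨y, hy⟩ := by
      rw [← sum_reducedLaplacian_mul G o r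
        (fun z hz => dirichletHeatKernel_eq_zero_left G hz y) ⟨x, hx⟩, Matrix.neg_mul,
        Matrix.neg_apply, Matrix.mul_apply]
      simp only [hker, ← hA]
    rw [hval]
    refine hent.congr_of_eventuallyEq (Eventually.of_forall fun s => ?_)
    exact hker s ⟨x, hx⟩
  · simp only [dirichletHeatKernel_eq_zero_right G hy, laplacian_const, neg_zero]
    exact hasDerivAt_const t 0

theorem dirichletHeatKernel_nonneg (o : V) (r : ℕ) {t : ℝ} (ht : 0 ≤ t) (x y : V) :
    0 ≤ dirichletHeatKernel G o r t x y := by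
  refine nonneg_of_supersolution G (finite_ballInterior_set G o r) (T := t)
    (f := fun x s => dirichletHeatKernel G o r s x y)
    (fun x hx s _ => (hasDerivAt_dirichletHeatKernel G hx y s).continuousAt.continuousWithinAt)
    (fun x hx s _ => hasDerivAt_dirichletHeatKernel G hx y s)
    (fun x _ s _ => (neg_add_cancel _).ge) (fun x hx => ?_)
    (fun x hx s _ => (dirichletHeatKernel_eq_zero_left G hx y).ge) x t ⟨ht, le_rfl⟩
  classical
  rw [dirichletHeatKernel_zero G hx]
  split_ifs <;> norm_num

theorem dirichletHeatKernel_mono (o : V) {t : ℝ} (ht : 0 ≤ t) (x y : V) :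
    Monotone fun r => dirichletHeatKernel G o r t x y := by
  intro r R hrR
  have hsub : ballInterior G o r ⊆ ballInterior G o R := ballInterior_mono G o hrR
  have hd : ∀ x ∈ ballInterior G o r, ∀ s, HasDerivAt
      (fun s => dirichletHeatKernel G o R s x y - dirichletHeatKernel G o r s x y)
      (-laplacian G (fun z => dirichletHeatKernel G o R s z y) x
        - -laplacian G (fun z => dirichletHeatKernel G o r s z y) x) s := fun x hx s =>
    (hasDerivAt_dirichletHeatKernel G (hsub hx) y s).sub (hasDerivAt_dirichletHeatKernel G hx y s)
  have := nonneg_of_supersolution G (finite_ballInterior_set G o r) (T := t)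
    (f := fun x s => dirichletHeatKernel G o R s x y - dirichletHeatKernel G o r s x y)
    (fun x hx s _ => (hd x hx s).continuousAt.continuousWithinAt)
    (fun x hx s _ => hd x hx s)
    (fun x _ s _ => by rw [laplacian_sub]; linarith) (fun x hx => ?_)
    (fun x hx s hs => ?_) x t ⟨ht, le_rfl⟩
  · exact sub_nonneg.mp this
  · rw [dirichletHeatKernel_zero G hx, dirichletHeatKernel_zero G (hsub hx), sub_self]
  · rw [dirichletHeatKernel_eq_zero_left G hx, sub_zero]
    exact dirichletHeatKernel_nonneg G o R hs.1 x y

/-- The heat `∑_y p_t^r(x, y)` that remains at time `t` in the ball with absorbing boundary. -/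
noncomputable def dirichletMass (o : V) (r : ℕ) (t : ℝ) (x : V) : ℝ :=
  ∑' y, dirichletHeatKernel G o r t x y

theorem dirichletMass_eq_sum (o : V) (r : ℕ) (t : ℝ) (x : V) :
    dirichletMass G o r t x =
      ∑ y ∈ (finite_ballInterior_set G o r).toFinset, dirichletHeatKernel G o r t x y :=
  tsum_eq_sum fun y hy => dirichletHeatKernel_eq_zero_right G (by simpa using hy) x

theorem dirichletMass_eq_zero {o : V} {r : ℕ} {x : V} (hx : x ∉ ballInterior G o r) (t : ℝ) :
    dirichletMass G o r t x = 0 := by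
  simp [dirichletMass, dirichletHeatKernel_eq_zero_left G hx]

theorem dirichletMass_zero {o : V} {r : ℕ} {x : V} (hx : x ∈ ballInterior G o r) :
    dirichletMass G o r 0 x = 1 := by
  classical
  simp [dirichletMass, dirichletHeatKernel_zero G hx]

theorem dirichletMass_nonneg (o : V) (r : ℕ) {t : ℝ} (ht : 0 ≤ t) (x : V) :
    0 ≤ dirichletMass G o r t x :=
  tsum_nonneg fun y => dirichletHeatKernel_nonneg G o r ht x y

theorem hasDerivAt_dirichletMass {o : V} {r : ℕ} {x : V} (hx : x ∈ ballInterior G o r) (t : ℝ) :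
    HasDerivAt (fun s => dirichletMass G o r s x)
      (-laplacian G (dirichletMass G o r t) x) t := by
  have h : dirichletMass G o r t = fun x => ∑ y ∈ (finite_ballInterior_set G o r).toFinset,
      dirichletHeatKernel G o r t x y := funext (dirichletMass_eq_sum G o r t)
  rw [h, laplacian_sum, ← Finset.sum_neg_distrib]
  simp only [dirichletMass_eq_sum]
  exact HasDerivAt.fun_sum fun y _ => hasDerivAt_dirichletHeatKernel G hx y t

theorem dirichletMass_le_one (o : V) (r : ℕ) {t : ℝ} (ht : 0 ≤ t) (x : V) :
    dirichletMass G o r t x ≤ 1 := by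
  have hd : ∀ x ∈ ballInterior G o r, ∀ s, HasDerivAt (fun s => 1 - dirichletMass G o r s x)
      (- -laplacian G (dirichletMass G o r s) x) s := fun x hx s =>
    (hasDerivAt_dirichletMass G hx s).const_sub 1
  have := nonneg_of_supersolution G (finite_ballInterior_set G o r) (T := t)
    (f := fun x s => 1 - dirichletMass G o r s x)
    (fun x hx s _ => (hd x hx s).continuousAt.continuousWithinAt)
    (fun x hx s _ => hd x hx s)
    (fun x _ s _ => by rw [laplacian_const_sub]; linarith)
    (fun x hx => by rw [dirichletMass_zero G hx, sub_self])
    (fun x hx s hs => by rw [dirichletMass_eq_zero G hx, sub_zero]; exact zero_le_one)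
    x t ⟨ht, le_rfl⟩
  linarith

theorem sum_dirichletHeatKernel_le_one (o : V) (r : ℕ) {t : ℝ} (ht : 0 ≤ t) (x : V)
    (F : Finset V) : ∑ y ∈ F, dirichletHeatKernel G o r t x y ≤ 1 := by
  refine le_trans (Summable.sum_le_tsum F
    (fun y _ => dirichletHeatKernel_nonneg G o r ht x y) ?_) (dirichletMass_le_one G o r ht x)
  exact summable_of_ne_finset_zero (s := (finite_ballInterior_set G o r).toFinset)
    fun y hy => dirichletHeatKernel_eq_zero_right G (by simpa using hy) x

end Dirichlet

/-! ### The heat kernel and the escape probability -/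

section HeatKernel

variable {V : Type*} (G : SimpleGraph V) [G.LocallyFinite]

theorem tendsto_dirichletHeatKernel (o : V) {t : ℝ} (ht : 0 ≤ t) (x y : V) :
    Tendsto (fun r => dirichletHeatKernel G o r t x y) atTop (𝓝 (heatKernel G o t x y)) := by
  refine tendsto_nhds_limUnder ⟨_, tendsto_atTop_ciSup (dirichletHeatKernel_mono G o ht x y) ?_⟩
  refine ⟨1, ?_⟩
  rintro _ ⟨r, rfl⟩
  simpa using sum_dirichletHeatKernel_le_one G o r ht x {y}

theorem dirichletHeatKernel_le_heatKernel (o : V) (r : ℕ) {t : ℝ} (ht : 0 ≤ t) (x y : V) :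
    dirichletHeatKernel G o r t x y ≤ heatKernel G o t x y :=
  (dirichletHeatKernel_mono G o ht x y).ge_of_tendsto (tendsto_dirichletHeatKernel G o ht x y) r

theorem heatKernel_nonneg (o : V) {t : ℝ} (ht : 0 ≤ t) (x y : V) : 0 ≤ heatKernel G o t x y :=
  (dirichletHeatKernel_nonneg G o 0 ht x y).trans (dirichletHeatKernel_le_heatKernel G o 0 ht x y)

theorem summable_heatKernel (o : V) {t : ℝ} (ht : 0 ≤ t) (x : V) :
    Summable (heatKernel G o t x) :=
  summable_of_sum_le (heatKernel_nonneg G o ht x) fun F =>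
    le_of_tendsto (tendsto_finsetSum F fun y _ => tendsto_dirichletHeatKernel G o ht x y)
      (Eventually.of_forall fun r => sum_dirichletHeatKernel_le_one G o r ht x F)

/-- The defect `1 - P_t 1 (x)`: the probability that the heat started at `x` has left the graph
by time `t`. The time is the last argument, as in `IsHeatSolution`. -/
noncomputable def escape (o : V) (x : V) (t : ℝ) : ℝ := 1 - heatSemigroup G o t (fun _ => 1) x

theorem tendsto_dirichletMass (o : V) {t : ℝ} (ht : 0 ≤ t) (x : V) :
    Tendsto (fun r => dirichletMass G o r t x) atTop (𝓝 (1 - escape G o x t)) := by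
  simp only [escape, sub_sub_cancel, heatSemigroup, mul_one]
  refine tendsto_tsum_of_dominated_convergence (summable_heatKernel G o ht x)
    (tendsto_dirichletHeatKernel G o ht x) (Eventually.of_forall fun r y => ?_)
  rw [Real.norm_of_nonneg (dirichletHeatKernel_nonneg G o r ht x y)]
  exact dirichletHeatKernel_le_heatKernel G o r ht x y

theorem escape_nonneg (o x : V) {t : ℝ} (ht : 0 ≤ t) : 0 ≤ escape G o x t := by
  have := le_of_tendsto (tendsto_dirichletMass G o ht x)
    (Eventually.of_forall fun r => dirichletMass_le_one G o r ht x)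
  linarith

theorem escape_le_one (o x : V) {t : ℝ} (ht : 0 ≤ t) : escape G o x t ≤ 1 := by
  have := ge_of_tendsto (tendsto_dirichletMass G o ht x)
    (Eventually.of_forall fun r => dirichletMass_nonneg G o r ht x)
  linarith

variable {G} in
theorem escape_zero (hG : G.Connected) (o x : V) : escape G o x 0 = 0 := by
  have h : Tendsto (fun r => dirichletMass G o r 0 x) atTop (𝓝 1) :=
    tendsto_const_nhds.congr' <| (eventually_mem_ballInterior G hG o x).mono fun r hr =>
      (dirichletMass_zero G hr).symm
  linarith [tendsto_nhds_unique h (tendsto_dirichletMass G o le_rfl x)]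

theorem continuous_dirichletMass (o : V) (r : ℕ) (x : V) :
    Continuous fun t => dirichletMass G o r t x := by
  by_cases hx : x ∈ ballInterior G o r
  · exact continuous_iff_continuousAt.mpr fun t => (hasDerivAt_dirichletMass G hx t).continuousAt
  · simp only [dirichletMass_eq_zero G hx, continuous_const]

variable {G} in
/-- The masses of the balls are Lipschitz in time with the degree as constant, independently of the
radius, so the bound passes to the limit. -/
theorem abs_escape_sub_le (hG : G.Connected) (o x : V) {s t : ℝ} (hs : 0 ≤ s) (ht : 0 ≤ t) :
    |escape G o x t - escape G o x s| ≤ G.degree x * |t - s| := by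
  have hlim := ((tendsto_dirichletMass G o ht x).sub (tendsto_dirichletMass G o hs x)).abs
  have hbound : ∀ᶠ r in atTop,
      |dirichletMass G o r t x - dirichletMass G o r s x| ≤ G.degree x * |t - s| := by
    filter_upwards [eventually_mem_ballInterior G hG o x] with r hr
    refine (convex_Ici (0 : ℝ)).norm_image_sub_le_of_norm_hasDerivWithin_le
      (fun τ _ => (hasDerivAt_dirichletMass G hr τ).hasDerivWithinAt) (fun τ hτ => ?_) hs ht
    rw [Real.norm_eq_abs, abs_neg]
    exact abs_laplacian_le_degree G (dirichletMass_nonneg G o r hτ)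
      (dirichletMass_le_one G o r hτ) x
  have := le_of_tendsto hlim hbound
  rwa [abs_sub_comm, show escape G o x s - escape G o x t
    = 1 - escape G o x t - (1 - escape G o x s) by ring]

variable {G} in
theorem continuousOn_escape (hG : G.Connected) (o x : V) :
    ContinuousOn (escape G o x) (Set.Ici 0) := by
  refine LipschitzOnWith.continuousOn (K := G.degree x) ?_
  refine LipschitzOnWith.of_dist_le_mul fun t ht s hs => ?_
  simpa [Real.dist_eq] using abs_escape_sub_le hG o x hs ht

variable {G} in
/-- Integrated form of the heat equation, obtained from the balls by dominated convergence. -/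
theorem escape_eq_integral (hG : G.Connected) (o x : V) {t : ℝ} (ht : 0 ≤ t) :
    escape G o x t = ∫ s in (0 : ℝ)..t, -laplacian G (fun y => escape G o y s) x := by
  have hcont : ∀ r, Continuous fun s => laplacian G (dirichletMass G o r s) x := fun r =>
    continuous_finsetSum _ fun y _ =>
      (continuous_dirichletMass G o r x).sub (continuous_dirichletMass G o r y)
  have hmem : ∀ s ∈ Set.uIoc 0 t, 0 ≤ s := fun s hs => by
    rw [Set.uIoc_of_le ht] at hs
    exact hs.1.le
  have hint : Tendsto (fun r => ∫ s in (0 : ℝ)..t, laplacian G (dirichletMass G o r s) x) atTop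
      (𝓝 (∫ s in (0 : ℝ)..t, -laplacian G (fun y => escape G o y s) x)) := by
    refine intervalIntegral.tendsto_integral_filter_of_dominated_convergence
      (fun _ => (G.degree x : ℝ)) (Eventually.of_forall fun r => (hcont r).aestronglyMeasurable)
      (Eventually.of_forall fun r => Eventually.of_forall fun s hs => ?_)
      intervalIntegrable_const (Eventually.of_forall fun s hs => ?_)
    · exact abs_laplacian_le_degree G (dirichletMass_nonneg G o r (hmem s hs))
        (dirichletMass_le_one G o r (hmem s hs)) x
    · rw [← laplacian_const_sub G 1]
      exact tendsto_laplacian G (fun y => tendsto_dirichletMass G o (hmem s hs) y) x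
  refine tendsto_nhds_unique ?_ hint
  have hmass : Tendsto (fun r => 1 - dirichletMass G o r t x) atTop (𝓝 (escape G o x t)) := by
    simpa using (tendsto_dirichletMass G o ht x).const_sub 1
  refine hmass.congr' ?_
  filter_upwards [eventually_mem_ballInterior G hG o x] with r hr
  have h := intervalIntegral.integral_eq_sub_of_hasDerivAt (a := 0) (b := t)
    (fun s _ => hasDerivAt_dirichletMass G hr s) ((hcont r).fun_neg.intervalIntegrable _ _)
  rw [intervalIntegral.integral_neg, dirichletMass_zero G hr] at h
  linarith

variable {G} in
/-- The escape probability solves the heat equation with zero initial data. -/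
theorem isHeatSolution_escape (hG : G.Connected) (o : V) :
    IsHeatSolution G (fun _ => 0) (escape G o) where
  continuousOn := continuousOn_escape hG o
  initial := escape_zero hG o
  hasDerivAt x t ht := by
    have hc : ContinuousOn (fun s => -laplacian G (fun y => escape G o y s) x) (Set.Ici 0) :=
      (continuousOn_laplacian G (continuousOn_escape hG o) x).neg
    have hint : IntervalIntegrable (fun s => -laplacian G (fun y => escape G o y s) x)
        MeasureTheory.volume 0 t :=
      (hc.mono (by rw [Set.uIcc_of_le ht.le]; exact Set.Icc_subset_Ici_self)).intervalIntegrable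
    have h := intervalIntegral.integral_hasDerivAt_right hint
      ((hc.mono Set.Ioi_subset_Ici_self).stronglyMeasurableAtFilter isOpen_Ioi t ht)
      (hc.continuousAt (Ici_mem_nhds ht))
    refine h.congr_of_eventuallyEq ?_
    filter_upwards [Ioi_mem_nhds ht] with s hs using escape_eq_integral hG o x (le_of_lt hs)

end HeatKernel

/-! ### Comparison with the escape probability -/

section Comparison

variable {V : Type*} {G : SimpleGraph V} [G.LocallyFinite]

/-- A subsolution of the heat equation with initial values at most `m` and all values at most `M`
is at most `m` plus `M - m` times the escape probability. -/
theorem le_add_mul_escape (o : V) {T m M : ℝ} {z z' : V → ℝ → ℝ}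
    (hcont : ∀ x, ContinuousOn (z x) (Set.Icc 0 T))
    (hderiv : ∀ x, ∀ t ∈ Set.Ioc 0 T, HasDerivAt (z x) (z' x t) t)
    (hsub : ∀ x, ∀ t ∈ Set.Ioc 0 T, z' x t + laplacian G (fun y => z y t) x ≤ 0)
    (hinit : ∀ x, z x 0 ≤ m) (hbd : ∀ x, ∀ t ∈ Set.Icc 0 T, z x t ≤ M)
    (x : V) {t : ℝ} (ht : t ∈ Set.Icc 0 T) :
    z x t ≤ m + (M - m) * escape G o x t := by
  have hball : ∀ r, z x t ≤ M - (M - m) * dirichletMass G o r t x := fun r => by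
    have hd : ∀ x ∈ ballInterior G o r, ∀ s, HasDerivAt
        (fun s => M - (M - m) * dirichletMass G o r s x)
        (-((M - m) * -laplacian G (dirichletMass G o r s) x)) s := fun x hx s =>
      ((hasDerivAt_dirichletMass G hx s).const_mul (M - m)).const_sub M
    refine sub_nonneg.mp (nonneg_of_supersolution G (finite_ballInterior_set G o r) (T := T)
      (f := fun x s => M - (M - m) * dirichletMass G o r s x - z x s)
      (fun x hx => ContinuousOn.sub
        (fun s _ => (hd x hx s).continuousAt.continuousWithinAt) (hcont x))
      (fun x hx s hs => (hd x hx s).sub (hderiv x s hs))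
      (fun x _ s hs => ?_) (fun x hx => ?_) (fun x hx s hs => ?_) x t ht)
    · rw [laplacian_sub, laplacian_const_sub, laplacian_const_mul]
      linarith [hsub x s hs]
    · rw [dirichletMass_zero G hx]
      linarith [hinit x]
    · rw [dirichletMass_eq_zero G hx]
      linarith [hbd x s hs]
  have hlim := ((tendsto_dirichletMass G o ht.1 x).const_mul (M - m)).const_sub M
  have := ge_of_tendsto hlim (Eventually.of_forall hball)
  linarith

/-- With `C = 1`, the escape probability is the largest heat solution with zero initial data that is
bounded above by `1`. -/
theorem IsHeatSolution.le_mul_escape {u : V → ℝ → ℝ} (hu : IsHeatSolution G (fun _ => 0) u) (o : V)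
    {C : ℝ} (hC : ∀ x t, 0 ≤ t → u x t ≤ C) (x : V) {t : ℝ} (ht : 0 ≤ t) :
    u x t ≤ C * escape G o x t := by
  have := le_add_mul_escape (G := G) o (T := t) (m := 0) (M := C) (z := u)
    (fun x => (hu.continuousOn x).mono Set.Icc_subset_Ici_self)
    (fun x s hs => hu.hasDerivAt x s hs.1) (fun x s _ => (neg_add_cancel _).le)
    (fun x => (hu.initial x).le) (fun x s hs => hC x s hs.1) x ⟨ht, le_rfl⟩
  simpa using this

theorem IsHeatSolution.neg {u₀ : V → ℝ} {u : V → ℝ → ℝ} (hu : IsHeatSolution G u₀ u) :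
    IsHeatSolution G (fun x => -u₀ x) (fun x t => -u x t) where
  continuousOn x := (hu.continuousOn x).neg
  hasDerivAt x t ht := by
    have h := laplacian_const_mul G (-1) (fun y => u y t) x
    simp only [neg_one_mul] at h
    rw [h]
    exact (hu.hasDerivAt x t ht).fun_neg
  initial x := by rw [hu.initial x]

theorem IsHeatSolution.abs_le_mul_escape {u : V → ℝ → ℝ} (hu : IsHeatSolution G (fun _ => 0) u)
    (o : V) {C : ℝ} (hC : ∀ x t, 0 ≤ t → |u x t| ≤ C) (x : V) {t : ℝ} (ht : 0 ≤ t) :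
    |u x t| ≤ C * escape G o x t := by
  have hneg : IsHeatSolution G (fun _ => 0) (fun x t => -u x t) := by simpa using hu.neg
  exact abs_le'.mpr
    ⟨hu.le_mul_escape o (fun y s hs => (le_abs_self _).trans (hC y s hs)) x ht,
      hneg.le_mul_escape o (fun y s hs => (neg_le_abs _).trans (hC y s hs)) x ht⟩

/-- If some bounded `c`-subharmonic function with `c < 0` is positive at `x`, then heat escapes:
`e^{-ct} v` is a subsolution which, with `P_t 1 = 1`, would be dominated by its initial supremum. -/
theorem IsSubharmonic.exists_escape_pos {c : ℝ} (hc : c < 0) {v : V → ℝ}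
    (hv : IsSubharmonic G c v) (hb : IsBoundedFun v) (o : V) {x : V} (hx : 0 < v x) :
    ∃ t, 0 < t ∧ 0 < escape G o x t := by
  obtain ⟨C, hC⟩ := hb
  have hCpos : 0 < C := hx.trans_le ((le_abs_self _).trans (hC x))
  -- A time `T` at which `e^{-cT} v x` exceeds `C`.
  obtain ⟨T, hT, hbig⟩ : ∃ T : ℝ, 0 < T ∧ C < Real.exp (-c * T) * v x := by
    have h : Tendsto (fun T : ℝ => Real.exp (-c * T) * v x) atTop atTop :=
      (Real.tendsto_exp_atTop.comp
        (tendsto_id.const_mul_atTop (neg_pos.mpr hc))).atTop_mul_const hx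
    exact ((eventually_gt_atTop 0).and (h.eventually_gt_atTop C)).exists
  refine ⟨T, hT, ?_⟩
  have hexp : ∀ s : ℝ, HasDerivAt (fun s => Real.exp (-c * s)) (Real.exp (-c * s) * -c) s :=
    fun s => by simpa using ((hasDerivAt_id s).const_mul (-c)).exp
  have hd : ∀ y s, HasDerivAt (fun s => Real.exp (-c * s) * v y)
      (Real.exp (-c * s) * -c * v y) s := fun y s => (hexp s).mul_const (v y)
  have hle := le_add_mul_escape (G := G) o (T := T) (m := C) (M := Real.exp (-c * T) * C)
    (z := fun y s => Real.exp (-c * s) * v y)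
    (fun y s _ => (hd y s).continuousAt.continuousWithinAt) (fun y s _ => hd y s)
    (fun y s _ => by
      rw [laplacian_const_mul]
      nlinarith [mul_le_mul_of_nonneg_left (hv y) (Real.exp_pos (-c * s)).le])
    (fun y => by simpa using (le_abs_self _).trans (hC y))
    (fun y s hs => by
      have h1 : Real.exp (-c * s) ≤ Real.exp (-c * T) := Real.exp_le_exp.mpr (by nlinarith [hs.2])
      calc Real.exp (-c * s) * v y ≤ Real.exp (-c * s) * C :=
            mul_le_mul_of_nonneg_left ((le_abs_self _).trans (hC y)) (Real.exp_pos _).le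
        _ ≤ Real.exp (-c * T) * C := mul_le_mul_of_nonneg_right h1 hCpos.le)
    x ⟨hT.le, le_rfl⟩
  refine lt_of_le_of_ne (escape_nonneg G o x hT.le) fun h0 => ?_
  simp only [← h0, mul_zero, add_zero] at hle
  linarith

end Comparison

/-! ### Positivity of the escape probability -/

section Positivity

variable {V : Type*} {G : SimpleGraph V} [G.LocallyFinite]

/-- A zero at a positive time forces zeros at all earlier times, since
`e^{deg(x) t} * escape G o x t` is non-decreasing. -/
theorem escape_eq_zero_of_le (hG : G.Connected) {o x : V} {s t : ℝ} (hs : 0 ≤ s) (hst : s ≤ t)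
    (h : escape G o x t = 0) : escape G o x s = 0 := by
  set d : ℝ := (G.degree x : ℝ)
  have hsol := isHeatSolution_escape hG o
  have hder : ∀ τ ∈ interior (Set.Ici (0 : ℝ)), HasDerivAt
      (fun τ => Real.exp (d * τ) * escape G o x τ)
      (Real.exp (d * τ) * d * escape G o x τ
        + Real.exp (d * τ) * -laplacian G (fun y => escape G o y τ) x) τ := fun τ hτ => by
    rw [interior_Ici] at hτ
    refine HasDerivAt.mul ?_ (hsol.hasDerivAt x τ hτ)
    simpa using ((hasDerivAt_id τ).const_mul d).exp
  have hmono : MonotoneOn (fun τ => Real.exp (d * τ) * escape G o x τ) (Set.Ici 0) := by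
    refine monotoneOn_of_deriv_nonneg (convex_Ici 0)
      (ContinuousOn.mul (by fun_prop) (hsol.continuousOn x))
      (fun τ hτ => (hder τ hτ).differentiableAt.differentiableWithinAt) fun τ hτ => ?_
    rw [(hder τ hτ).deriv, laplacian_eq_degree_mul_sub]
    have hτ0 : 0 ≤ τ := interior_subset hτ
    have : 0 ≤ Real.exp (d * τ) * ∑ y ∈ G.neighborFinset x, escape G o y τ :=
      mul_nonneg (Real.exp_pos _).le (Finset.sum_nonneg fun y _ => escape_nonneg G o y hτ0)
    linarith
  have := hmono (Set.mem_Ici.mpr hs) (Set.mem_Ici.mpr (hs.trans hst)) hst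
  simp only [h, mul_zero] at this
  exact le_antisymm (nonpos_of_mul_nonpos_right this (Real.exp_pos _)) (escape_nonneg G o x hs)

/-- If the escape probability vanishes at one vertex and one positive time, the heat equation makes
it vanish at all neighbours, and hence at all vertices, for all earlier times. -/
theorem escape_eq_zero_of_lt (hG : G.Connected) {o x : V} {t : ℝ} (h : escape G o x t = 0) (y : V) :
    ∀ s ∈ Set.Ioo 0 t, escape G o y s = 0 := by
  obtain ⟨p⟩ := hG.preconnected x y
  have hx : ∀ s ∈ Set.Ioo 0 t, escape G o x s = 0 := fun s hs =>
    escape_eq_zero_of_le hG hs.1.le hs.2.le h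
  clear h
  induction p with
  | nil => exact hx
  | @cons x y _ hadj _ ih =>
    refine ih fun s hs => ?_
    have hd0 : HasDerivAt (escape G o x) 0 s := by
      refine (hasDerivAt_const s (0 : ℝ)).congr_of_eventuallyEq ?_
      filter_upwards [Ioo_mem_nhds hs.1 hs.2] with τ hτ using hx τ hτ
    have heq := hd0.unique ((isHeatSolution_escape hG o).hasDerivAt x s hs.1)
    rw [laplacian_eq_degree_mul_sub, hx s hs] at heq
    have hsum : ∑ z ∈ G.neighborFinset x, escape G o z s = 0 := by linarith
    exact (Finset.sum_eq_zero_iff_of_nonneg fun z _ => escape_nonneg G o z hs.1.le).mp hsum y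
      (by simpa using hadj)

/-- If no heat escapes up to time `a`, then restarting the clock at time `a` gives again a heat
solution with zero initial data, which the escape probability dominates. -/
theorem escape_add_le (hG : G.Connected) {o : V} {a : ℝ} (ha : 0 ≤ a)
    (h : ∀ y, escape G o y a = 0) (x : V) {s : ℝ} (hs : 0 ≤ s) :
    escape G o x (s + a) ≤ escape G o x s := by
  have hsol := isHeatSolution_escape hG o
  have hshift : IsHeatSolution G (fun _ => 0) (fun y τ => escape G o y (τ + a)) :=
    { continuousOn := fun y => (hsol.continuousOn y).comp (by fun_prop)
        fun τ hτ => add_nonneg (Set.mem_Ici.mp hτ) ha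
      hasDerivAt := fun y τ hτ => (hsol.hasDerivAt y (τ + a) (by linarith)).comp_add_const τ a
      initial := fun y => by simpa using h y }
  simpa using hshift.le_mul_escape o (C := 1)
    (fun y τ hτ => escape_le_one G o y (add_nonneg hτ ha)) x hs

theorem escape_pos (hG : G.Connected) {o x₀ : V} {t₀ : ℝ} (ht₀ : 0 < t₀)
    (h₀ : 0 < escape G o x₀ t₀) (x : V) {t : ℝ} (ht : 0 < t) : 0 < escape G o x t := by
  refine lt_of_le_of_ne (escape_nonneg G o x ht.le) fun h => h₀.ne' ?_
  have hz := escape_eq_zero_of_lt hG h.symm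
  set a := t / 2
  have hapos : 0 < a := half_pos ht
  have hza : ∀ y, escape G o y a = 0 := fun y => hz y a ⟨hapos, half_lt_self ht⟩
  have hiter : ∀ n : ℕ, escape G o x₀ (n * a) = 0 := fun n => by
    induction n with
    | zero => simpa using escape_zero hG o x₀
    | succ n ih =>
      have hn : 0 ≤ n * a := by positivity
      refine le_antisymm ?_ (escape_nonneg G o x₀ (by positivity))
      have := escape_add_le hG hapos.le hza x₀ hn
      rw [ih] at this
      rwa [Nat.cast_succ, add_mul, one_mul]
  obtain ⟨n, hn⟩ := exists_nat_gt (t₀ / a)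
  exact escape_eq_zero_of_le hG ht₀.le ((div_lt_iff₀ hapos).mp hn).le (hiter n)

end Positivity

/-! ### The resolvent of the escape probability -/

section Resolvent

open MeasureTheory

variable {V : Type*} {G : SimpleGraph V} [G.LocallyFinite]

/-- The Laplace transform `∫_0^∞ e^{ct} (1 - P_t 1 (x)) dt` of the escape probability, meaningful
for `c < 0`. -/
noncomputable def escapeTransform (G : SimpleGraph V) [G.LocallyFinite] (o : V) (c : ℝ) (x : V) :
    ℝ :=
  ∫ t in Set.Ioi 0, Real.exp (c * t) * escape G o x t

theorem integrableOn_exp_mul_escape (hG : G.Connected) (o x : V) {c : ℝ} (hc : c < 0) :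
    IntegrableOn (fun t => Real.exp (c * t) * escape G o x t) (Set.Ioi 0) := by
  refine Integrable.mono' (integrableOn_exp_mul_Ioi hc 0) ?_ ?_
  · exact (ContinuousOn.mul (by fun_prop)
      ((continuousOn_escape hG o x).mono Set.Ioi_subset_Ici_self)).aestronglyMeasurable
      measurableSet_Ioi
  · refine (ae_restrict_mem measurableSet_Ioi).mono fun t (ht : 0 < t) => ?_
    rw [Real.norm_of_nonneg (mul_nonneg (Real.exp_pos _).le (escape_nonneg G o x ht.le))]
    exact mul_le_of_le_one_right (Real.exp_pos _).le (escape_le_one G o x ht.le)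

theorem isBoundedFun_escapeTransform (hG : G.Connected) (o : V) {c : ℝ} (hc : c < 0) :
    IsBoundedFun (escapeTransform G o c) := by
  refine ⟨∫ t in Set.Ioi (0 : ℝ), Real.exp (c * t), fun x => ?_⟩
  rw [escapeTransform, abs_of_nonneg (setIntegral_nonneg measurableSet_Ioi fun t (ht : 0 < t) =>
    mul_nonneg (Real.exp_pos _).le (escape_nonneg G o x ht.le))]
  exact setIntegral_mono_on (integrableOn_exp_mul_escape hG o x hc) (integrableOn_exp_mul_Ioi hc 0)
    measurableSet_Ioi fun t (ht : 0 < t) =>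
      mul_le_of_le_one_right (Real.exp_pos _).le (escape_le_one G o x ht.le)

theorem escapeTransform_pos (hG : G.Connected) {o x : V} {c : ℝ} (hc : c < 0)
    (h : ∀ t, 0 < t → 0 < escape G o x t) : 0 < escapeTransform G o c x := by
  have hpos : ∀ t ∈ Set.Ioi (0 : ℝ), 0 < Real.exp (c * t) * escape G o x t := fun t ht =>
    mul_pos (Real.exp_pos _) (h t ht)
  rw [escapeTransform, setIntegral_pos_iff_support_of_nonneg_ae
    ((ae_restrict_mem measurableSet_Ioi).mono fun t ht => (hpos t ht).le)
    (integrableOn_exp_mul_escape hG o x hc)]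
  have hsupp : Set.Ioi 0 ⊆ Function.support fun t => Real.exp (c * t) * escape G o x t :=
    fun t ht => (hpos t ht).ne'
  rw [Set.inter_eq_right.mpr hsupp, Real.volume_Ioi]
  exact ENNReal.zero_lt_top

/-- Integration by parts in the heat equation: the boundary terms of `e^{ct} * escape G o x t`
vanish at both ends, by the initial condition and by boundedness. -/
theorem isHarmonic_escapeTransform (hG : G.Connected) (o : V) {c : ℝ} (hc : c < 0) :
    IsHarmonic G c (escapeTransform G o c) := by
  intro x
  have hint := fun y => integrableOn_exp_mul_escape hG o y hc
  have hsol := isHeatSolution_escape hG o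
  have hlapint : IntegrableOn
      (fun t => laplacian G (fun y => Real.exp (c * t) * escape G o y t) x) (Set.Ioi 0) :=
    integrable_finsetSum _ fun y _ => (hint x).sub (hint y)
  have hlap : laplacian G (escapeTransform G o c) x
      = ∫ t in Set.Ioi 0, laplacian G (fun y => Real.exp (c * t) * escape G o y t) x := by
    refine Eq.trans ?_ (integral_finsetSum _ fun y _ => (hint x).sub (hint y)).symm
    exact Finset.sum_congr rfl fun y _ => (integral_sub (hint x) (hint y)).symm
  have hzero := integral_Ioi_of_hasDerivAt_of_tendsto (a := 0) (m := 0)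
    (f := fun t => Real.exp (c * t) * escape G o x t)
    (f' := fun t => c * (Real.exp (c * t) * escape G o x t)
      - laplacian G (fun y => Real.exp (c * t) * escape G o y t) x)
    (ContinuousOn.mul (by fun_prop) (hsol.continuousOn x) 0 Set.self_mem_Ici)
    (fun t ht => by
      have h := HasDerivAt.mul (c := fun t => Real.exp (c * t))
        (by simpa using ((hasDerivAt_id t).const_mul c).exp) (hsol.hasDerivAt x t ht)
      refine h.congr_deriv ?_
      rw [laplacian_const_mul]
      ring)
    (((hint x).const_mul c).sub hlapint)
    (by
      have hexp : Tendsto (fun t => Real.exp (c * t)) atTop (𝓝 0) :=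
        Real.tendsto_exp_atBot.comp (tendsto_id.const_mul_atTop_of_neg hc)
      refine squeeze_zero' ?_ ?_ hexp
      · filter_upwards [eventually_ge_atTop 0] with t ht
        exact mul_nonneg (Real.exp_pos _).le (escape_nonneg G o x ht)
      · filter_upwards [eventually_ge_atTop 0] with t ht
        exact mul_le_of_le_one_right (Real.exp_pos _).le (escape_le_one G o x ht))
  rw [integral_sub ((hint x).const_mul c) hlapint, integral_const_mul, ← hlap,
    escape_zero hG o x] at hzero
  simp only [mul_zero, sub_zero] at hzero
  exact (sub_eq_zero.mp hzero).symm

end Resolvent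

end GraphHeat

/-! ### The equivalences -/

open GraphHeat in
theorem mainTheorem5 {V : Type*} [Infinite V] (G : SimpleGraph V) [G.LocallyFinite]
    (hG : G.Connected) (o : V) :
    (∀ t : ℝ, 0 < t → ∀ x : V, Summable (GraphHeat.heatKernel G o t x)) ∧
    List.TFAE [
      -- stochastic incompleteness, at some point and at every point
      ∃ t : ℝ, 0 < t ∧ ∃ x : V, GraphHeat.heatSemigroup G o t (fun _ => 1) x < 1,
      ∀ t : ℝ, 0 < t → ∀ x : V, GraphHeat.heatSemigroup G o t (fun _ => 1) x < 1,
      -- bounded harmonic functions, positive or non-zero, for every or for some negative constant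
      ∀ c : ℝ, c < 0 → ∃ v : V → ℝ,
        GraphHeat.IsBoundedFun v ∧ (∀ x, 0 < v x) ∧ GraphHeat.IsHarmonic G c v,
      ∀ c : ℝ, c < 0 → ∃ v : V → ℝ,
        GraphHeat.IsBoundedFun v ∧ v ≠ 0 ∧ GraphHeat.IsHarmonic G c v,
      ∃ c : ℝ, c < 0 ∧ ∃ v : V → ℝ,
        GraphHeat.IsBoundedFun v ∧ (∀ x, 0 < v x) ∧ GraphHeat.IsHarmonic G c v,
      ∃ c : ℝ, c < 0 ∧ ∃ v : V → ℝ,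
        GraphHeat.IsBoundedFun v ∧ v ≠ 0 ∧ GraphHeat.IsHarmonic G c v,
      -- bounded subharmonic functions, positive or with a positive value somewhere
      ∀ c : ℝ, c < 0 → ∃ v : V → ℝ,
        GraphHeat.IsBoundedFun v ∧ (∀ x, 0 < v x) ∧ GraphHeat.IsSubharmonic G c v,
      ∀ c : ℝ, c < 0 → ∃ v : V → ℝ,
        GraphHeat.IsBoundedFun v ∧ (∃ x, 0 < v x) ∧ GraphHeat.IsSubharmonic G c v,
      ∃ c : ℝ, c < 0 ∧ ∃ v : V → ℝ,
        GraphHeat.IsBoundedFun v ∧ (∀ x, 0 < v x) ∧ GraphHeat.IsSubharmonic G c v,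
      ∃ c : ℝ, c < 0 ∧ ∃ v : V → ℝ,
        GraphHeat.IsBoundedFun v ∧ (∃ x, 0 < v x) ∧ GraphHeat.IsSubharmonic G c v,
      -- a bounded non-zero solution of the heat equation with zero initial data
      ∃ u : V → ℝ → ℝ, GraphHeat.IsHeatSolution G (fun _ => 0) u ∧
        (∃ C : ℝ, ∀ x, ∀ t, 0 ≤ t → |u x t| ≤ C) ∧ ∃ x, ∃ t, 0 ≤ t ∧ u x t ≠ 0] := by
  have hlt : ∀ t x, heatSemigroup G o t (fun _ => 1) x < 1 ↔ 0 < escape G o x t := fun t x =>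
    sub_pos.symm
  have hpos : ∀ v : V → ℝ, (∀ x, 0 < v x) → ∃ x, 0 < v x := fun v hv => ⟨o, hv o⟩
  have hne : ∀ v : V → ℝ, (∀ x, 0 < v x) → v ≠ 0 := fun v hv h => (hv o).ne' (congrFun h o)
  refine ⟨fun t ht x => summable_heatKernel G o ht.le x, ?_⟩
  tfae_have 1 → 2 := by
    rintro ⟨t₀, ht₀, x₀, h₀⟩ t ht x
    exact (hlt t x).mpr (escape_pos hG ht₀ ((hlt t₀ x₀).mp h₀) x ht)
  tfae_have 2 → 3 := fun h c hc =>
    ⟨escapeTransform G o c, isBoundedFun_escapeTransform hG o hc,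
      fun x => escapeTransform_pos hG hc fun t ht => (hlt t x).mp (h t ht x),
      isHarmonic_escapeTransform hG o hc⟩
  tfae_have 3 → 4 := fun h c hc =>
    let ⟨v, hb, hv, hh⟩ := h c hc
    ⟨v, hb, hne v hv, hh⟩
  tfae_have 3 → 5 := fun h => ⟨-1, by norm_num, h (-1) (by norm_num)⟩
  tfae_have 4 → 6 := fun h => ⟨-1, by norm_num, h (-1) (by norm_num)⟩
  tfae_have 5 → 6 := fun ⟨c, hc, v, hb, hv, hh⟩ => ⟨c, hc, v, hb, hne v hv, hh⟩
  tfae_have 3 → 7 := fun h c hc =>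
    let ⟨v, hb, hv, hh⟩ := h c hc
    ⟨v, hb, hv, fun x => (hh x).le⟩
  tfae_have 7 → 8 := fun h c hc =>
    let ⟨v, hb, hv, hs⟩ := h c hc
    ⟨v, hb, hpos v hv, hs⟩
  tfae_have 7 → 9 := fun h => ⟨-1, by norm_num, h (-1) (by norm_num)⟩
  tfae_have 8 → 10 := fun h => ⟨-1, by norm_num, h (-1) (by norm_num)⟩
  tfae_have 9 → 10 := fun ⟨c, hc, v, hb, hv, hs⟩ => ⟨c, hc, v, hb, hpos v hv, hs⟩
  tfae_have 6 → 10 := by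
    -- A non-zero harmonic function or its negative is positive somewhere.
    rintro ⟨c, hc, v, ⟨C, hC⟩, hv, hh⟩
    obtain ⟨x, hx⟩ := Function.ne_iff.mp hv
    rcases lt_or_gt_of_ne hx with hx | hx
    · refine ⟨c, hc, fun y => 0 - v y, ⟨C, fun y => by simpa using hC y⟩, ⟨x, ?_⟩, fun y => ?_⟩
      · simpa using hx
      · rw [laplacian_const_sub, hh y]
        linarith
    · exact ⟨c, hc, v, ⟨C, hC⟩, ⟨x, hx⟩, fun y => (hh y).le⟩
  tfae_have 10 → 1 := by
    rintro ⟨c, hc, v, hb, ⟨x, hx⟩, hs⟩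
    obtain ⟨t, ht, h⟩ := hs.exists_escape_pos hc hb o hx
    exact ⟨t, ht, x, (hlt t x).mpr h⟩
  tfae_have 1 → 11 := by
    rintro ⟨t, ht, x, h⟩
    refine ⟨escape G o, isHeatSolution_escape hG o, ⟨1, fun y s hs => ?_⟩, x, t, ht.le,
      ((hlt t x).mp h).ne'⟩
    rw [abs_of_nonneg (escape_nonneg G o y hs)]
    exact escape_le_one G o y hs
  tfae_have 11 → 1 := by
    rintro ⟨u, hu, ⟨C, hC⟩, x, t, ht, hne⟩
    have htpos : 0 < t := lt_of_le_of_ne ht fun h => hne (h ▸ hu.initial x)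
    have habs := hu.abs_le_mul_escape o hC x ht
    refine ⟨t, htpos, x, (hlt t x).mpr ?_⟩
    refine lt_of_le_of_ne (escape_nonneg G o x ht) fun h => hne ?_
    rwa [← h, mul_zero, abs_nonpos_iff] at habs
  tfae_finish
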